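/- Let $n\ge 0$, let $u_0,v_0\in L^2(\mathbb R^n)$, and for $t\in\mathbb R$ let $e^{it\Delta}$ be the free Schrödinger group on $L^2(\mathbb R^n)$, i.e. $\widehat{e^{it\Delta}u_0}(\xi)=e^{-it|\xi|^2}\,\widehat u_0(\xi)$ with $\widehat f(\xi)=(2\pi)^{-n/2}\int_{\mathbb R^n}e^{-ix\cdot\xi}f(x)\,dx$ (extended to $L^2$). Put $$F(t)=\big\|\,|x-y|\,e^{it\Delta}u_0(x)\,e^{it\Delta}v_0(y)\big\|^2_{L^2(\mathbb R^{2n}_{x,y})}\in[0,\infty].$$ Then $F$ is convex on $\mathbb R$ as a function with values in $[0,\infty]$: for all $a,b\in\mathbb R$ and $s\in[0,1]$, $$F((1-s)a+sb)\le(1-s)F(a)+sF(b)\qquad(0\cdot\infty=0).$$ Moreover, if $F$ is finite at two different times, or if $F$ is finite at one time and $\big\||\xi-\eta|\,\widehat u_0(\xi)\,\widehat v_0(\eta)\big\|_{L^2(\mathbb R^{2n}_{\xi,\eta})}<\infty$, then $F(t)<\infty$ for every $t\in\mathbb R$, and $F$ is a convex real-valued function on $\mathbb R$. -/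

import Mathlib

open MeasureTheory FourierTransform
open scoped ENNReal

/-- The symbol of `e^{itΔ}`. With Mathlib's normalization
`𝓕 f ξ = ∫ exp (-2πi x·ξ) f x dx` the operator `Δ` has symbol `-4π²|ξ|²`. -/
noncomputable def schrodingerSymbol {n : ℕ} (t : ℝ) (ξ : EuclideanSpace ℝ (Fin n)) : ℂ :=
  Complex.exp (-(Complex.I * ((4 * Real.pi ^ 2 * t * ‖ξ‖ ^ 2 : ℝ) : ℂ)))

theorem norm_schrodingerSymbol {n : ℕ} (t : ℝ) (ξ : EuclideanSpace ℝ (Fin n)) :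
    ‖schrodingerSymbol t ξ‖ = 1 := by
  rw [schrodingerSymbol, ← mul_neg, ← Complex.ofReal_neg, Complex.norm_exp_I_mul_ofReal]

theorem continuous_schrodingerSymbol {n : ℕ} (t : ℝ) :
    Continuous (schrodingerSymbol (n := n) t) := by
  unfold schrodingerSymbol
  fun_prop

theorem memLp_schrodingerSymbol_mul {n : ℕ} (t : ℝ)
    (g : Lp ℂ 2 (volume : Measure (EuclideanSpace ℝ (Fin n)))) :
    MemLp (fun ξ => schrodingerSymbol t ξ * g ξ) 2 volume := by
  refine (Lp.memLp g).of_le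
    ((continuous_schrodingerSymbol t).aestronglyMeasurable.mul (Lp.aestronglyMeasurable g)) ?_
  filter_upwards with ξ
  rw [norm_mul, norm_schrodingerSymbol, one_mul]

/-- The free Schrödinger evolution `e^{itΔ} u₀` of `u₀ ∈ L²(ℝⁿ)`, that is, the inverse Fourier
transform of the symbol of `e^{itΔ}` times the (Plancherel) Fourier transform of `u₀`. -/
noncomputable def freeSchrodinger {n : ℕ} (t : ℝ)
    (u₀ : Lp ℂ 2 (volume : Measure (EuclideanSpace ℝ (Fin n)))) :
    Lp ℂ 2 (volume : Measure (EuclideanSpace ℝ (Fin n))) :=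
  𝓕⁻ ((memLp_schrodingerSymbol_mul t (𝓕 u₀)).toLp)

/-- The square `‖ |x - y| u(x) v(y) ‖²` of the norm in `L²(ℝⁿ × ℝⁿ)`, a value in `[0, ∞]`. -/
noncomputable def interactionNormSq {n : ℕ}
    (u v : Lp ℂ 2 (volume : Measure (EuclideanSpace ℝ (Fin n)))) : ℝ≥0∞ :=
  eLpNorm (fun p : EuclideanSpace ℝ (Fin n) × EuclideanSpace ℝ (Fin n) =>
    ((‖p.1 - p.2‖ : ℝ) : ℂ) * u p.1 * v p.2) 2 (volume.prod volume) ^ 2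

/-! In the Heisenberg picture the free flow turns `x - y` into an operator affine in time, so the
norm of each component of `x - y` on the evolved state is the norm of `(A + tB)G` for a fixed vector
`G`, hence convex in `t`. Squaring preserves this, and the squares sum to `F`.

Domains of unbounded operators are avoided by exponentiating. On the Fourier side, up to a
unimodular factor, multiplication by `exp (2πih⟨x - y, w⟩)` at time `t` becomes the unitary
`V_t(hw)` = `galileanShift t (h • w)`, acting on the time-independent `G = 𝓕 u ⊗ 𝓕 v`. Affinity in
`t` is the Weyl-type relation `galileanShift_galileanShift`: for `α + β = 1`, `V_a(αhw) V_b(βhw)`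
equals `V_{αa+βb}(hw)` up to a scalar phase of size `O(h²)`. The norm of `(V_t(hw) - 1)G` is at most
`h` times the directional norm at time `t`; conversely, dividing by `h` and applying Fatou recovers
that norm (`eLpNorm_mul_le_of_phase_sub_one`). This yields `directionalNorm_combination_le`, valid
for all real weights of sum one: weights in `[0, 1]` give convexity, the others propagate finiteness
from two times to all.

If instead one time and the Fourier-side norm are finite, `V_t(hw)` and `V_a(hw)` differ by a phase
whose linear part in `h` is controlled by `ξ - η`. -/

/-- The unimodular number `exp (i x)`. -/
noncomputable def phase (x : ℝ) : ℂ := Complex.exp (Complex.I * x)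

theorem norm_phase (x : ℝ) : ‖phase x‖ = 1 := Complex.norm_exp_I_mul_ofReal x

theorem enorm_phase (x : ℝ) : ‖phase x‖ₑ = 1 := Complex.enorm_exp_I_mul_ofReal x

theorem phase_add (x y : ℝ) : phase (x + y) = phase x * phase y := by
  simp [phase, mul_add, Complex.exp_add]

theorem phase_zero : phase 0 = 1 := by simp [phase]

theorem continuous_phase : Continuous phase := by unfold phase; fun_prop

theorem enorm_phase_sub_one_le (x : ℝ) : ‖phase x - 1‖ₑ ≤ ‖x‖ₑ :=
  Real.enorm_exp_I_mul_ofReal_sub_one_le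

theorem schrodingerSymbol_eq_phase {n : ℕ} (t : ℝ) (ξ : EuclideanSpace ℝ (Fin n)) :
    schrodingerSymbol t ξ = phase (-(4 * Real.pi ^ 2 * t * ‖ξ‖ ^ 2)) := by
  rw [schrodingerSymbol, phase, Complex.ofReal_neg, mul_neg]

/-! ### Modulation and translation under the Fourier transform -/

section PhaseSpaceShifts

theorem continuous_modulation {E : Type*} [NormedAddCommGroup E] [InnerProductSpace ℝ E] (w : E) :
    Continuous fun x : E => phase (2 * Real.pi * inner ℝ x w) := by
  unfold phase; fun_prop

variable {E : Type*} [NormedAddCommGroup E] [InnerProductSpace ℝ E] [FiniteDimensional ℝ E]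
  [MeasurableSpace E] [BorelSpace E]

theorem memLp_modulateLp (w : E) (u : Lp ℂ 2 (volume : Measure E)) :
    MemLp (fun x => phase (2 * Real.pi * inner ℝ x w) * u x) 2 volume := by
  refine (Lp.memLp u).of_le
    ((continuous_modulation w).aestronglyMeasurable.mul (Lp.aestronglyMeasurable u)) ?_
  filter_upwards with x
  rw [norm_mul, norm_phase, one_mul]

/-- Multiplication by the character `x ↦ exp (2πi ⟨x, w⟩)` on `L²`. -/
noncomputable def modulateLp (w : E) (u : Lp ℂ 2 (volume : Measure E)) :
    Lp ℂ 2 (volume : Measure E) :=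
  (memLp_modulateLp w u).toLp

theorem coeFn_modulateLp (w : E) (u : Lp ℂ 2 (volume : Measure E)) :
    modulateLp w u =ᵐ[volume] fun x => phase (2 * Real.pi * inner ℝ x w) * u x :=
  MemLp.coeFn_toLp _

theorem isometry_modulateLp (w : E) :
    Isometry (modulateLp w : Lp ℂ 2 (volume : Measure E) → Lp ℂ 2 (volume : Measure E)) := by
  intro u v
  rw [Lp.edist_def, Lp.edist_def]
  refine eLpNorm_congr_norm_ae ?_
  filter_upwards [coeFn_modulateLp w u, coeFn_modulateLp w v] with x hu hv
  rw [Pi.sub_apply, Pi.sub_apply, hu, hv, ← mul_sub, norm_mul, norm_phase, one_mul]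

/-- Translation by `w` on `L²`. -/
noncomputable def translateLp (w : E) (u : Lp ℂ 2 (volume : Measure E)) :
    Lp ℂ 2 (volume : Measure E) :=
  Lp.compMeasurePreserving (fun x => x - w) (measurePreserving_sub_right volume w) u

theorem coeFn_translateLp (w : E) (u : Lp ℂ 2 (volume : Measure E)) :
    translateLp w u =ᵐ[volume] fun x => u (x - w) :=
  Lp.coeFn_compMeasurePreserving u _

/-- Both sides are continuous in `f`, so Schwartz functions suffice; there it is a change of
variables in the integral. -/
theorem fourierInv_translateLp (w : E) (f : Lp ℂ 2 (volume : Measure E)) :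
    𝓕⁻ (translateLp w f) = modulateLp w (𝓕⁻ f) := by
  refine DenseRange.induction_on
    (p := fun f : Lp ℂ 2 (volume : Measure E) => 𝓕⁻ (translateLp w f) = modulateLp w (𝓕⁻ f))
    (SchwartzMap.denseRange_toLpCLM (p := 2) ENNReal.ofNat_ne_top) f ?_ ?_
  · exact isClosed_eq
      ((Lp.fourierTransformₗᵢ E ℂ).symm.continuous.comp
        (Lp.isometry_compMeasurePreserving _).continuous)
      ((isometry_modulateLp w).continuous.comp (Lp.fourierTransformₗᵢ E ℂ).symm.continuous)
  · intro g
    have hg : translateLp w (g.toLp 2) = (g.compSubConstCLM ℂ w).toLp 2 := rfl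
    rw [SchwartzMap.toLpCLM_apply, hg, SchwartzMap.toLp_fourierInv_eq,
      SchwartzMap.toLp_fourierInv_eq]
    apply Lp.ext
    filter_upwards [SchwartzMap.coeFn_toLp (𝓕⁻ (g.compSubConstCLM ℂ w)) 2 volume,
      coeFn_modulateLp w ((𝓕⁻ g).toLp 2), SchwartzMap.coeFn_toLp (𝓕⁻ g) 2 volume] with x h₁ h₂ h₃
    rw [h₁, h₂, h₃, SchwartzMap.fourierInv_coe, SchwartzMap.fourierInv_coe,
      Real.fourierInv_eq', Real.fourierInv_eq', ← integral_const_mul,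
      ← integral_add_right_eq_self _ w]
    congr 1 with v
    rw [SchwartzMap.compSubConstCLM_apply, add_sub_cancel_right, smul_eq_mul, smul_eq_mul, phase,
      ← mul_assoc, ← Complex.exp_add, inner_add_left, real_inner_comm w x]
    congr 2
    push_cast
    ring

theorem fourier_modulateLp (w : E) (u : Lp ℂ 2 (volume : Measure E)) :
    𝓕 (modulateLp w u) = translateLp w (𝓕 u) := by
  have h := fourierInv_translateLp w (𝓕 u)
  rw [fourierInv_fourier_eq] at h
  rw [← h, fourier_fourierInv_eq]

end PhaseSpaceShifts

/-! ### Tensor products in `L²` -/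

section Tensor

variable {X Y : Type*} [MeasurableSpace X] [MeasurableSpace Y] {μ : Measure X} {ν : Measure Y}
  [SFinite ν]

theorem memLp_tensor (u : Lp ℂ 2 μ) (v : Lp ℂ 2 ν) :
    MemLp (fun p : X × Y => u p.1 * v p.2) 2 (μ.prod ν) := by
  refine ⟨((Lp.stronglyMeasurable u).comp_measurable measurable_fst).mul
    ((Lp.stronglyMeasurable v).comp_measurable measurable_snd) |>.aestronglyMeasurable, ?_⟩
  rw [eLpNorm_lt_top_iff_lintegral_rpow_enorm_lt_top two_ne_zero ENNReal.ofNat_ne_top]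
  have hu := (eLpNorm_lt_top_iff_lintegral_rpow_enorm_lt_top two_ne_zero ENNReal.ofNat_ne_top).1
    (Lp.memLp u).2
  have hv := (eLpNorm_lt_top_iff_lintegral_rpow_enorm_lt_top two_ne_zero ENNReal.ofNat_ne_top).1
    (Lp.memLp v).2
  simp only [enorm_mul, ENNReal.mul_rpow_of_nonneg _ _ ENNReal.toReal_nonneg]
  rw [lintegral_prod_mul
    ((Lp.stronglyMeasurable u).enorm.pow_const _).aemeasurable
    ((Lp.stronglyMeasurable v).enorm.pow_const _).aemeasurable]
  exact ENNReal.mul_lt_top hu hv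

/-- The tensor product of two `L²` functions, as an element of `L²` of the product space. -/
noncomputable def tensor (u : Lp ℂ 2 μ) (v : Lp ℂ 2 ν) : Lp ℂ 2 (μ.prod ν) :=
  (memLp_tensor u v).toLp

theorem coeFn_tensor (u : Lp ℂ 2 μ) (v : Lp ℂ 2 ν) :
    tensor u v =ᵐ[μ.prod ν] fun p => u p.1 * v p.2 :=
  MemLp.coeFn_toLp _

theorem inner_tensor [SFinite μ] (u u' : Lp ℂ 2 μ) (v v' : Lp ℂ 2 ν) :
    inner ℂ (tensor u v) (tensor u' v') = inner ℂ u u' * inner ℂ v v' := by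
  rw [L2.inner_def, L2.inner_def, L2.inner_def, ← integral_prod_mul]
  refine integral_congr_ae ?_
  filter_upwards [coeFn_tensor u v, coeFn_tensor u' v'] with p h h'
  rw [h, h']
  simp only [RCLike.inner_apply, map_mul]
  ring

theorem eLpNorm_tensor_sub_tensor (u u' : Lp ℂ 2 μ) (v v' : Lp ℂ 2 ν) :
    eLpNorm (fun p : X × Y => u p.1 * v p.2 - u' p.1 * v' p.2) 2 (μ.prod ν) =
      ‖tensor u v - tensor u' v'‖ₑ := by
  rw [Lp.enorm_def]
  refine eLpNorm_congr_ae ?_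
  filter_upwards [coeFn_tensor u v, coeFn_tensor u' v',
    Lp.coeFn_sub (tensor u v) (tensor u' v')] with p h h' hs
  rw [hs, Pi.sub_apply, h, h']

/-- The squared norm expands into inner products of pure tensors, which factor. Plancherel can thus
be applied in each variable separately, with no Fourier transform on the product space. -/
theorem norm_tensor_sub_tensor_congr [SFinite μ] {X' Y' : Type*} [MeasurableSpace X'] [MeasurableSpace Y']
    {μ' : Measure X'} {ν' : Measure Y'} [SFinite μ'] [SFinite ν']
    (A : Lp ℂ 2 μ →ₗᵢ[ℂ] Lp ℂ 2 μ') (B : Lp ℂ 2 ν →ₗᵢ[ℂ] Lp ℂ 2 ν')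
    (u u' : Lp ℂ 2 μ) (v v' : Lp ℂ 2 ν) :
    ‖tensor (A u) (B v) - tensor (A u') (B v')‖ = ‖tensor u v - tensor u' v'‖ := by
  rw [← sq_eq_sq₀ (norm_nonneg _) (norm_nonneg _), ← Complex.ofReal_inj]
  push_cast
  simp only [← Complex.coe_algebraMap, ← inner_self_eq_norm_sq_to_K (𝕜 := ℂ), inner_sub_left,
    inner_sub_right, inner_tensor, LinearIsometry.inner_map_map]

end Tensor

theorem enorm_complex_ofReal (x : ℝ) : ‖(x : ℂ)‖ₑ = ‖x‖ₑ := by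
  rw [← ofReal_norm, ← ofReal_norm, Complex.norm_real]

/-! ### Multiplication operators and their unitary groups -/

section DifferenceQuotient

variable {X : Type*} [MeasurableSpace X] {μ : Measure X}

theorem eLpNorm_phase_sub_one_mul_le (z : X → ℝ) (U : X → ℂ) (h : ℝ) (p : ℝ≥0∞) :
    eLpNorm (fun x => (phase (h * z x) - 1) * U x) p μ ≤
      ‖h‖ₑ * eLpNorm (fun x => (z x : ℂ) * U x) p μ := by
  rw [← eLpNorm_const_smul]
  refine eLpNorm_mono_enorm fun x => ?_
  rw [Pi.smul_apply, enorm_smul, enorm_mul, enorm_mul, ← mul_assoc]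
  gcongr
  refine (enorm_phase_sub_one_le _).trans_eq ?_
  rw [enorm_mul, enorm_complex_ofReal]

theorem eLpNorm_phase_const_mul (θ : X → ℝ) (U : X → ℂ) (p : ℝ≥0∞) :
    eLpNorm (fun x => phase (θ x) * U x) p μ = eLpNorm U p μ :=
  eLpNorm_congr_enorm_ae (.of_forall fun x => by rw [enorm_mul, enorm_phase, one_mul])

theorem tendsto_phase_difference_quotient (z : ℝ) :
    Filter.Tendsto (fun h : ℝ => (h : ℂ)⁻¹ * (phase (h * z) - 1)) (nhdsWithin 0 {0}ᶜ)
      (nhds (Complex.I * z)) := by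
  have h : HasDerivAt (fun h : ℝ => phase (h * z)) (Complex.I * z) 0 := by
    have h₁ : HasDerivAt (fun h : ℝ => Complex.I * ((h * z : ℝ) : ℂ)) (Complex.I * z) 0 := by
      have := ((hasDerivAt_id (0 : ℝ)).mul_const z).ofReal_comp.const_mul Complex.I
      simpa using this
    simpa [phase] using h₁.cexp
  simpa [phase_zero] using hasDerivAt_iff_tendsto_slope_zero.1 h

/-- A bound on `x ↦ z x * U x` follows from one on the difference quotients of
`h ↦ exp (i h z) U` at `0`. -/
theorem eLpNorm_mul_le_of_phase_sub_one {z : X → ℝ} (hz : Measurable z) {U : X → ℂ}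
    (hU : AEStronglyMeasurable U μ) {p : ℝ≥0∞} {C c : ℝ≥0∞} (hc : c ≠ ∞)
    (H : ∀ h : ℝ, 0 < h → eLpNorm (fun x => (phase (h * z x) - 1) * U x) p μ ≤
      ENNReal.ofReal h * C + ENNReal.ofReal (h ^ 2) * c) :
    eLpNorm (fun x => (z x : ℂ) * U x) p μ ≤ C := by
  have hh : ∀ k : ℕ, (0 : ℝ) < 1 / ((k : ℝ) + 1) := fun k => Nat.one_div_pos_of_nat
  have hlim := tendsto_one_div_add_atTop_nhds_zero_nat (𝕜 := ℝ)
  set ε : ℕ → ℝ := fun k => 1 / ((k : ℝ) + 1) with hε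
  have hI : eLpNorm (fun x => (z x : ℂ) * U x) p μ =
      eLpNorm (fun x => (Complex.I * z x) * U x) p μ :=
    eLpNorm_congr_norm_ae (.of_forall fun x => by simp)
  let f : ℕ → X → ℂ := fun k x => ((ε k : ℂ)⁻¹ * (phase (ε k * z x) - 1)) * U x
  have hf : ∀ k, AEStronglyMeasurable (f k) μ := fun k =>
    ((((continuous_phase.measurable.comp (hz.const_mul _)).sub_const 1).const_mul
      _).aestronglyMeasurable).mul hU
  have hlimf : ∀ x, Filter.Tendsto (fun k => f k x) Filter.atTop
      (nhds ((Complex.I * z x) * U x)) := fun x =>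
    ((tendsto_phase_difference_quotient (z x)).comp
      (tendsto_nhdsWithin_iff.2 ⟨hlim, .of_forall fun k => (hh k).ne'⟩)).mul_const _
  have hb : ∀ k, eLpNorm (f k) p μ ≤ C + ENNReal.ofReal (ε k) * c := by
    intro k
    have hpos : 0 < ε k := hh k
    have h0 : ENNReal.ofReal (ε k) ≠ 0 := (ENNReal.ofReal_pos.2 hpos).ne'
    have e : f k = (ε k : ℂ)⁻¹ • fun x => (phase (ε k * z x) - 1) * U x := by
      ext x; simp [f, mul_assoc]
    have en : ‖(ε k : ℂ)⁻¹‖ₑ = (ENNReal.ofReal (ε k))⁻¹ := by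
      rw [enorm_inv (by exact_mod_cast hpos.ne'), enorm_complex_ofReal,
        Real.enorm_of_nonneg hpos.le]
    rw [e, eLpNorm_const_smul, en]
    refine (mul_le_mul_right (H _ hpos) _).trans_eq ?_
    rw [mul_add, ← mul_assoc, ENNReal.inv_mul_cancel h0 ENNReal.ofReal_ne_top, one_mul,
      ENNReal.ofReal_pow hpos.le, sq, ← mul_assoc, ← mul_assoc,
      ENNReal.inv_mul_cancel h0 ENNReal.ofReal_ne_top, one_mul]
  have hlimb : Filter.Tendsto (fun k => C + ENNReal.ofReal (ε k) * c) Filter.atTop (nhds C) := by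
    have := ENNReal.Tendsto.mul_const (b := c) (ENNReal.tendsto_ofReal hlim) (.inr hc)
    simpa using this.const_add C
  rw [hI, ← hlimb.liminf_eq]
  -- Fatou's lemma: finiteness of the left side is a conclusion, never an assumption.
  exact (Lp.eLpNorm_lim_le_liminf_eLpNorm hf _ (.of_forall hlimf)).trans
    (Filter.liminf_le_liminf (.of_forall hb))

end DifferenceQuotient

/-! ### Galilean shifts and their composition law -/

section GalileanShift

variable {E : Type*} [NormedAddCommGroup E] [InnerProductSpace ℝ E]

/-- Conjugating by the two-particle Schrödinger flow at time `t` the translation by `(w, -w)`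
of the two frequencies yields this operator. -/
noncomputable def galileanShift (t : ℝ) (w : E) (G : E × E → ℂ) (p : E × E) : ℂ :=
  phase (4 * Real.pi ^ 2 * t * (2 * inner ℝ (p.1 - p.2) w - 2 * ‖w‖ ^ 2)) *
    G (p.1 - w, p.2 + w)

theorem galileanShift_sub (t : ℝ) (w : E) (G G' : E × E → ℂ) :
    galileanShift t w (G - G') = galileanShift t w G - galileanShift t w G' := by
  ext p; simp [galileanShift, mul_sub]

/-- The scalar phase is quadratic in `w`, so it does not contribute to first order when `w` is
replaced by `h • w`. -/
theorem galileanShift_galileanShift {α β : ℝ} (h : α + β = 1) (a b : ℝ) (w : E)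
    (G : E × E → ℂ) (p : E × E) :
    galileanShift a (α • w) (galileanShift b (β • w) G) p =
      phase (8 * Real.pi ^ 2 * (α * a + β * b - α ^ 2 * a - 2 * α * β * b - β ^ 2 * b) *
        ‖w‖ ^ 2) * galileanShift (α * a + β * b) w G p := by
  have hp : (p.1 - α • w - β • w, p.2 + α • w + β • w) = (p.1 - w, p.2 + w) := by
    rw [sub_sub, add_assoc, ← add_smul, h, one_smul]
  simp only [galileanShift]
  rw [hp, ← mul_assoc, ← mul_assoc, ← phase_add, ← phase_add]
  congr 2
  simp only [inner_sub_left, inner_add_left, inner_smul_left, inner_smul_right, norm_smul,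
    mul_pow, Real.norm_eq_abs, sq_abs, real_inner_self_eq_norm_sq, conj_trivial]
  ring

theorem galileanShift_eq_phase_mul (a t : ℝ) (w : E) (G : E × E → ℂ) (p : E × E) :
    galileanShift t w G p =
      phase (4 * Real.pi ^ 2 * (t - a) * (2 * inner ℝ (p.1 - p.2) w - 2 * ‖w‖ ^ 2)) *
        galileanShift a w G p := by
  simp only [galileanShift]
  rw [← mul_assoc, ← phase_add]
  congr 2
  ring

variable [FiniteDimensional ℝ E] [MeasurableSpace E] [BorelSpace E]

theorem measurePreserving_sub_add (w : E) :
    MeasurePreserving (fun p : E × E => (p.1 - w, p.2 + w)) (volume.prod volume)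
      (volume.prod volume) :=
  (measurePreserving_sub_right volume w).prod (measurePreserving_add_right volume w)

theorem stronglyMeasurable_galileanShift (t : ℝ) (w : E) {G : E × E → ℂ}
    (hG : StronglyMeasurable G) : StronglyMeasurable (galileanShift t w G) := by
  refine StronglyMeasurable.mul (Continuous.stronglyMeasurable ?_)
    (hG.comp_measurable (measurePreserving_sub_add w).measurable)
  exact continuous_phase.comp (by fun_prop)

theorem eLpNorm_galileanShift (t : ℝ) (w : E) {G : E × E → ℂ} (hG : StronglyMeasurable G)
    (p : ℝ≥0∞) :
    eLpNorm (galileanShift t w G) p (volume.prod volume) = eLpNorm G p (volume.prod volume) := by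
  unfold galileanShift
  rw [eLpNorm_phase_const_mul]
  exact eLpNorm_comp_measurePreserving hG.aestronglyMeasurable (measurePreserving_sub_add w)

theorem eLpNorm_galileanShift_combination_sub_le {α β : ℝ} (h : α + β = 1) (a b : ℝ) (w : E)
    {G : E × E → ℂ} (hG : StronglyMeasurable G) :
    eLpNorm (galileanShift (α * a + β * b) w G - G) 2 (volume.prod volume) ≤
      eLpNorm (galileanShift a (α • w) G - G) 2 (volume.prod volume) +
        eLpNorm (galileanShift b (β • w) G - G) 2 (volume.prod volume) +
        ‖8 * Real.pi ^ 2 * (α * a + β * b - α ^ 2 * a - 2 * α * β * b - β ^ 2 * b) * ‖w‖ ^ 2‖ₑ *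
          eLpNorm G 2 (volume.prod volume) := by
  set κ := 8 * Real.pi ^ 2 * (α * a + β * b - α ^ 2 * a - 2 * α * β * b - β ^ 2 * b) * ‖w‖ ^ 2
    with hκ
  have hV := fun t (w : E) => stronglyMeasurable_galileanShift t w hG
  have hd : StronglyMeasurable (galileanShift b (β • w) G - G) := (hV _ _).sub hG
  have hm : StronglyMeasurable fun p : E × E => (phase (κ * 1) - 1) * G p := hG.const_mul _
  -- Telescoping `V_a V_b - 1 = (V_a - 1) + V_a (V_b - 1)`, with the scalar `phase κ` corrected at
  -- the end; `κ * 1` fits the difference bound with `z = 1`.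
  have e : (fun p => phase κ * (galileanShift (α * a + β * b) w G - G) p) =
      (galileanShift a (α • w) G - G) + galileanShift a (α • w) (galileanShift b (β • w) G - G) -
        fun p => (phase (κ * 1) - 1) * G p := by
    ext p
    simp only [galileanShift_sub, Pi.add_apply, Pi.sub_apply, galileanShift_galileanShift h, mul_one]
    ring
  rw [← eLpNorm_phase_const_mul (fun _ => κ), e]
  refine (eLpNorm_sub_le (((hV _ _).sub hG).add
    (stronglyMeasurable_galileanShift _ _ hd)).aestronglyMeasurable
    hm.aestronglyMeasurable one_le_two).trans ?_
  refine add_le_add ((eLpNorm_add_le ((hV _ _).sub hG).aestronglyMeasurable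
    (stronglyMeasurable_galileanShift _ _ hd).aestronglyMeasurable one_le_two).trans ?_) ?_
  · rw [eLpNorm_galileanShift _ _ hd]
  · simpa using eLpNorm_phase_sub_one_mul_le (fun _ => 1) G κ 2 (μ := volume.prod volume)

theorem eLpNorm_galileanShift_sub_le (a t h : ℝ) (w : E) {G : E × E → ℂ}
    (hG : StronglyMeasurable G) :
    eLpNorm (galileanShift t (h • w) G - G) 2 (volume.prod volume) ≤
      eLpNorm (galileanShift a (h • w) G - G) 2 (volume.prod volume) +
        ‖4 * Real.pi * (t - a) * h‖ₑ * eLpNorm (fun p : E × E =>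
          ((2 * Real.pi * inner ℝ (p.1 - p.2) w : ℝ) : ℂ) * G p) 2 (volume.prod volume) +
        ‖-(8 * Real.pi ^ 2 * (t - a) * ‖h • w‖ ^ 2)‖ₑ * eLpNorm G 2 (volume.prod volume) := by
  set κ := -(8 * Real.pi ^ 2 * (t - a) * ‖h • w‖ ^ 2) with hκ
  set z : E × E → ℝ := fun p => 2 * Real.pi * inner ℝ (p.1 - p.2) w with hz
  set τ := 4 * Real.pi * (t - a) * h with hτ
  have hV := fun t (w : E) => stronglyMeasurable_galileanShift t w hG
  have hzc : Continuous z := by fun_prop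
  have hpz : Continuous fun p => phase (τ * z p) := continuous_phase.comp (by fun_prop)
  -- Splits the phase into a part linear in `h`, bounded by the weighted norm of `G`, and a constant
  -- of order `h ^ 2`.
  have hθ : ∀ p : E × E, 4 * Real.pi ^ 2 * (t - a) *
      (2 * inner ℝ (p.1 - p.2) (h • w) - 2 * ‖h • w‖ ^ 2) = τ * z p + κ := by
    intro p
    simp only [hκ, hz, hτ, inner_smul_right]
    ring
  have e : galileanShift t (h • w) G - G =
      (fun p => phase (τ * z p + κ) * (galileanShift a (h • w) G - G) p) +
        (fun p => (phase (τ * z p) - 1) * G p) +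
        fun p => phase (τ * z p) * ((phase (κ * 1) - 1) * G p) := by
    ext p
    simp only [Pi.add_apply, Pi.sub_apply, galileanShift_eq_phase_mul a t, hθ, mul_one, phase_add]
    ring
  have h₁ : StronglyMeasurable
      fun p => phase (τ * z p + κ) * (galileanShift a (h • w) G - G) p :=
    (continuous_phase.comp (by fun_prop)).stronglyMeasurable.mul ((hV _ _).sub hG)
  have h₂ : StronglyMeasurable fun p => (phase (τ * z p) - 1) * G p :=
    (hpz.sub continuous_const).stronglyMeasurable.mul hG
  have h₃ : StronglyMeasurable fun p => phase (τ * z p) * ((phase (κ * 1) - 1) * G p) :=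
    hpz.stronglyMeasurable.mul (hG.const_mul _)
  rw [e]
  refine (eLpNorm_add_le (h₁.add h₂).aestronglyMeasurable h₃.aestronglyMeasurable
    one_le_two).trans ?_
  refine add_le_add ((eLpNorm_add_le h₁.aestronglyMeasurable h₂.aestronglyMeasurable
    one_le_two).trans (add_le_add ?_ ?_)) ?_
  · rw [eLpNorm_phase_const_mul]
  · exact eLpNorm_phase_sub_one_mul_le z G τ 2
  · rw [eLpNorm_phase_const_mul]
    simpa using eLpNorm_phase_sub_one_mul_le (fun _ => 1) G κ 2 (μ := volume.prod volume)

end GalileanShift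

/-! ### Directional norms along the flow -/

section Interaction

variable {n : ℕ}

local notation "𝔼" => EuclideanSpace ℝ (Fin n)
local notation "L2" => Lp ℂ 2 (volume : Measure 𝔼)

/-- The tensor product of two `L²` functions, as a function of two variables. -/
noncomputable def tensorFun (u v : L2) (p : 𝔼 × 𝔼) : ℂ := u p.1 * v p.2

theorem stronglyMeasurable_tensorFun (u v : L2) : StronglyMeasurable (tensorFun u v) :=
  ((Lp.stronglyMeasurable u).comp_measurable measurable_fst).mul
    ((Lp.stronglyMeasurable v).comp_measurable measurable_snd)

theorem eLpNorm_tensorFun_ne_top (u v : L2) :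
    eLpNorm (tensorFun u v) 2 (volume.prod volume) ≠ ∞ :=
  (memLp_tensor u v).2.ne

/-- The norm `‖2π ⟨x - y, w⟩ u(x) v(y)‖` in `L²(ℝⁿ × ℝⁿ)`. -/
noncomputable def directionalNorm (w : 𝔼) (u v : L2) : ℝ≥0∞ :=
  eLpNorm (fun p : 𝔼 × 𝔼 => ((2 * Real.pi * inner ℝ (p.1 - p.2) w : ℝ) : ℂ) * tensorFun u v p) 2
    (volume.prod volume)

theorem coeFn_fourier_freeSchrodinger (t : ℝ) (u : L2) :
    (𝓕 (freeSchrodinger t u) : L2) =ᵐ[volume] fun ξ => schrodingerSymbol t ξ * 𝓕 u ξ := by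
  rw [freeSchrodinger, fourier_fourierInv_eq]
  exact MemLp.coeFn_toLp _

theorem coeFn_fourier_modulateLp_freeSchrodinger (t : ℝ) (w : 𝔼) (u : L2) :
    (𝓕 (modulateLp w (freeSchrodinger t u)) : L2) =ᵐ[volume]
      fun ξ => schrodingerSymbol t (ξ - w) * 𝓕 u (ξ - w) := by
  rw [fourier_modulateLp]
  filter_upwards [coeFn_translateLp w (𝓕 (freeSchrodinger t u)),
    (measurePreserving_sub_right volume w).quasiMeasurePreserving.ae
      (coeFn_fourier_freeSchrodinger t u)] with ξ h₁ h₂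
  rw [h₁, h₂]

theorem eLpNorm_phase_sub_one_mul_tensorFun (w : 𝔼) (u v : L2) :
    eLpNorm (fun p : 𝔼 × 𝔼 => (phase (2 * Real.pi * inner ℝ (p.1 - p.2) w) - 1) *
      tensorFun u v p) 2 (volume.prod volume) =
    eLpNorm (fun p : 𝔼 × 𝔼 => 𝓕 (modulateLp w u) p.1 * 𝓕 (modulateLp (-w) v) p.2 -
      𝓕 u p.1 * 𝓕 v p.2) 2 (volume.prod volume) := by
  have hF := norm_tensor_sub_tensor_congr (Lp.fourierTransformₗᵢ 𝔼 ℂ).toLinearIsometry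
    (Lp.fourierTransformₗᵢ 𝔼 ℂ).toLinearIsometry (modulateLp w u) u (modulateLp (-w) v) v
  rw [eLpNorm_tensor_sub_tensor]
  refine Eq.trans ?_ (congrArg ENNReal.ofReal hF.symm |>.trans (ofReal_norm _))
  rw [ofReal_norm, ← eLpNorm_tensor_sub_tensor]
  refine eLpNorm_congr_ae ?_
  filter_upwards [Measure.quasiMeasurePreserving_fst.ae (coeFn_modulateLp w u),
    Measure.quasiMeasurePreserving_snd.ae (coeFn_modulateLp (-w) v)] with p h₁ h₂
  rw [h₁, h₂, inner_sub_left, mul_sub, sub_eq_add_neg (2 * Real.pi * _), phase_add, inner_neg_right,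
    mul_neg, tensorFun]
  ring

theorem phase_schrodinger_shift (t : ℝ) (w ξ η : 𝔼) :
    schrodingerSymbol t (ξ - w) * schrodingerSymbol t (η - -w) =
      phase (-(4 * Real.pi ^ 2 * t * ‖ξ‖ ^ 2) + -(4 * Real.pi ^ 2 * t * ‖η‖ ^ 2)) *
        phase (4 * Real.pi ^ 2 * t * (2 * inner ℝ (ξ - η) w - 2 * ‖w‖ ^ 2)) := by
  rw [schrodingerSymbol_eq_phase, schrodingerSymbol_eq_phase, ← phase_add, ← phase_add,
    sub_neg_eq_add, norm_sub_sq_real, norm_add_sq_real, inner_sub_left]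
  congr 1
  ring

/-- Modulation by `(w, -w)` translates the two frequencies; expanding `‖ξ - w‖ ^ 2 + ‖η + w‖ ^ 2`
and dropping the common unimodular symbol leaves the shift. -/
theorem eLpNorm_phase_sub_one_mul_freeSchrodinger (t : ℝ) (w : 𝔼) (u v : L2) :
    eLpNorm (fun p : 𝔼 × 𝔼 => (phase (2 * Real.pi * inner ℝ (p.1 - p.2) w) - 1) *
      tensorFun (freeSchrodinger t u) (freeSchrodinger t v) p) 2 (volume.prod volume) =
    eLpNorm (galileanShift t w (tensorFun (𝓕 u) (𝓕 v)) - tensorFun (𝓕 u) (𝓕 v)) 2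
      (volume.prod volume) := by
  rw [eLpNorm_phase_sub_one_mul_tensorFun]
  refine Eq.trans (eLpNorm_congr_ae ?_) (eLpNorm_phase_const_mul (fun p =>
    -(4 * Real.pi ^ 2 * t * ‖p.1‖ ^ 2) + -(4 * Real.pi ^ 2 * t * ‖p.2‖ ^ 2)) _ _)
  filter_upwards [
    Measure.quasiMeasurePreserving_fst.ae (coeFn_fourier_modulateLp_freeSchrodinger t w u),
    Measure.quasiMeasurePreserving_snd.ae (coeFn_fourier_modulateLp_freeSchrodinger t (-w) v),
    Measure.quasiMeasurePreserving_fst.ae (coeFn_fourier_freeSchrodinger t u),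
    Measure.quasiMeasurePreserving_snd.ae (coeFn_fourier_freeSchrodinger t v)] with p h₁ h₂ h₃ h₄
  rw [h₁, h₂, h₃, h₄, mul_mul_mul_comm, phase_schrodinger_shift, schrodingerSymbol_eq_phase,
    schrodingerSymbol_eq_phase, phase_add (-_), sub_neg_eq_add, Pi.sub_apply, galileanShift, tensorFun, tensorFun]
  ring

theorem eLpNorm_galileanShift_sub_le_directionalNorm (t h : ℝ) (w : 𝔼) (u v : L2) :
    eLpNorm (galileanShift t (h • w) (tensorFun (𝓕 u) (𝓕 v)) - tensorFun (𝓕 u) (𝓕 v)) 2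
      (volume.prod volume) ≤
      ‖h‖ₑ * directionalNorm w (freeSchrodinger t u) (freeSchrodinger t v) := by
  rw [← eLpNorm_phase_sub_one_mul_freeSchrodinger]
  simpa only [inner_smul_right, mul_left_comm _ h, directionalNorm] using eLpNorm_phase_sub_one_mul_le
    (μ := volume.prod volume) (fun p : 𝔼 × 𝔼 => 2 * Real.pi * inner ℝ (p.1 - p.2) w)
    (tensorFun (freeSchrodinger t u) (freeSchrodinger t v)) h 2

theorem directionalNorm_freeSchrodinger_le {t : ℝ} {w : 𝔼} {u v : L2} {C c : ℝ≥0∞} (hc : c ≠ ∞)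
    (H : ∀ h : ℝ, 0 < h → eLpNorm (galileanShift t (h • w) (tensorFun (𝓕 u) (𝓕 v)) -
      tensorFun (𝓕 u) (𝓕 v)) 2 (volume.prod volume) ≤
        ENNReal.ofReal h * C + ENNReal.ofReal (h ^ 2) * c) :
    directionalNorm w (freeSchrodinger t u) (freeSchrodinger t v) ≤ C := by
  refine eLpNorm_mul_le_of_phase_sub_one (z := fun p : 𝔼 × 𝔼 =>
    2 * Real.pi * inner ℝ (p.1 - p.2) w) (Continuous.measurable (by fun_prop))
    (stronglyMeasurable_tensorFun _ _).aestronglyMeasurable hc fun h hh => ?_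
  have := H h hh
  rw [← eLpNorm_phase_sub_one_mul_freeSchrodinger] at this
  simpa only [inner_smul_right, mul_left_comm _ h] using this

theorem directionalNorm_combination_le {α β : ℝ} (hαβ : α + β = 1) (a b : ℝ) (w : 𝔼) (u v : L2) :
    directionalNorm w (freeSchrodinger (α * a + β * b) u) (freeSchrodinger (α * a + β * b) v) ≤
      ‖α‖ₑ * directionalNorm w (freeSchrodinger a u) (freeSchrodinger a v) +
        ‖β‖ₑ * directionalNorm w (freeSchrodinger b u) (freeSchrodinger b v) := by
  set κ := 8 * Real.pi ^ 2 * (α * a + β * b - α ^ 2 * a - 2 * α * β * b - β ^ 2 * b) with hκ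
  refine directionalNorm_freeSchrodinger_le
    (c := ‖κ * ‖w‖ ^ 2‖ₑ * eLpNorm (tensorFun (𝓕 u) (𝓕 v)) 2 (volume.prod volume))
    (ENNReal.mul_ne_top enorm_ne_top (eLpNorm_tensorFun_ne_top _ _)) fun h hh => ?_
  refine (eLpNorm_galileanShift_combination_sub_le hαβ a b (h • w)
    (stronglyMeasurable_tensorFun _ _)).trans ?_
  rw [← hκ, smul_smul, smul_smul, mul_add]
  refine add_le_add (add_le_add ?_ ?_) (le_of_eq ?_)
  · refine (eLpNorm_galileanShift_sub_le_directionalNorm _ _ _ _ _).trans_eq ?_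
    rw [enorm_mul, Real.enorm_of_nonneg hh.le, mul_comm ‖α‖ₑ, mul_assoc]
  · refine (eLpNorm_galileanShift_sub_le_directionalNorm _ _ _ _ _).trans_eq ?_
    rw [enorm_mul, Real.enorm_of_nonneg hh.le, mul_comm ‖β‖ₑ, mul_assoc]
  · rw [← mul_assoc, ← Real.enorm_of_nonneg (sq_nonneg h), ← enorm_mul, norm_smul, mul_pow,
      Real.norm_eq_abs, sq_abs]
    ring_nf

theorem directionalNorm_freeSchrodinger_le_add (a t : ℝ) (w : 𝔼) (u v : L2) :
    directionalNorm w (freeSchrodinger t u) (freeSchrodinger t v) ≤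
      directionalNorm w (freeSchrodinger a u) (freeSchrodinger a v) +
        ‖4 * Real.pi * (t - a)‖ₑ * directionalNorm w (𝓕 u) (𝓕 v) := by
  refine directionalNorm_freeSchrodinger_le (c := ‖-(8 * Real.pi ^ 2 * (t - a) * ‖w‖ ^ 2)‖ₑ *
    eLpNorm (tensorFun (𝓕 u) (𝓕 v)) 2 (volume.prod volume))
    (ENNReal.mul_ne_top enorm_ne_top (eLpNorm_tensorFun_ne_top _ _)) fun h hh => ?_
  refine (eLpNorm_galileanShift_sub_le a t h w (stronglyMeasurable_tensorFun _ _)).trans ?_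
  rw [mul_add]
  refine add_le_add (add_le_add ?_ (le_of_eq ?_)) (le_of_eq ?_)
  · refine (eLpNorm_galileanShift_sub_le_directionalNorm _ _ _ _ _).trans_eq ?_
    rw [Real.enorm_of_nonneg hh.le]
  · rw [enorm_mul, Real.enorm_of_nonneg hh.le, mul_comm _ (ENNReal.ofReal h), mul_assoc,
      directionalNorm]
  · rw [← mul_assoc, ← Real.enorm_of_nonneg (sq_nonneg h), ← enorm_mul, norm_smul, mul_pow,
      Real.norm_eq_abs, sq_abs]
    ring_nf

/-! ### From directional norms to `F` -/

theorem eLpNorm_two_sq {X F : Type*} [MeasurableSpace X] [NormedAddCommGroup F] (μ : Measure X)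
    (f : X → F) : eLpNorm f 2 μ ^ 2 = ∫⁻ x, ‖f x‖ₑ ^ 2 ∂μ := by
  simpa using eLpNorm_nnreal_pow_eq_lintegral (f := f) (μ := μ) (two_ne_zero : (2 : NNReal) ≠ 0)

theorem interactionNormSq_eq_sum (u v : L2) :
    interactionNormSq u v =
      ∑ j, directionalNorm ((2 * Real.pi)⁻¹ • EuclideanSpace.single j 1) u v ^ 2 := by
  simp only [interactionNormSq, directionalNorm, eLpNorm_two_sq]
  rw [← lintegral_finsetSum']
  · congr 1 with p
    have hnorm : ‖p.1 - p.2‖ₑ ^ 2 = ∑ j, ‖(p.1 - p.2) j‖ₑ ^ 2 := by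
      rw [← ofReal_norm, ← ENNReal.ofReal_pow (norm_nonneg _), EuclideanSpace.norm_sq_eq,
        ENNReal.ofReal_sum_of_nonneg fun _ _ => by positivity]
      exact Finset.sum_congr rfl fun j _ => by
        rw [ENNReal.ofReal_pow (norm_nonneg _), ofReal_norm]
    have hpi : (2 * Real.pi) ≠ 0 := by positivity
    simp only [tensorFun, mul_assoc, enorm_mul _ (_ * _), mul_pow, ← Finset.sum_mul]
    rw [enorm_complex_ofReal, enorm_norm, hnorm]
    congr 1
    refine Finset.sum_congr rfl fun j _ => ?_
    rw [enorm_complex_ofReal, inner_smul_right, ← mul_assoc 2, mul_inv_cancel_left₀ hpi,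
      EuclideanSpace.inner_single_right]
    simp
  · intro j _
    refine ((Continuous.stronglyMeasurable ?_).mul
      (stronglyMeasurable_tensorFun u v)).enorm.pow_const 2 |>.aemeasurable
    fun_prop

theorem interactionNormSq_lt_top_iff {u v : L2} :
    interactionNormSq u v < ∞ ↔
      ∀ j, directionalNorm ((2 * Real.pi)⁻¹ • EuclideanSpace.single j 1) u v < ∞ := by
  simp [interactionNormSq_eq_sum, ENNReal.sum_lt_top, ENNReal.pow_lt_top_iff]

theorem interactionNormSq_freeSchrodinger_convex (u v : L2) (a b : ℝ) {s : ℝ} (h0 : 0 ≤ s)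
    (h1 : s ≤ 1) :
    interactionNormSq (freeSchrodinger ((1 - s) * a + s * b) u)
        (freeSchrodinger ((1 - s) * a + s * b) v) ≤
      ENNReal.ofReal (1 - s) * interactionNormSq (freeSchrodinger a u) (freeSchrodinger a v) +
        ENNReal.ofReal s * interactionNormSq (freeSchrodinger b u) (freeSchrodinger b v) := by
  simp only [interactionNormSq_eq_sum, Finset.mul_sum, ← Finset.sum_add_distrib]
  refine Finset.sum_le_sum fun j _ => ?_
  have h := directionalNorm_combination_le (sub_add_cancel 1 s) a b
    ((2 * Real.pi)⁻¹ • EuclideanSpace.single j 1) u v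
  rw [Real.enorm_of_nonneg h0, Real.enorm_of_nonneg (sub_nonneg.2 h1)] at h
  refine (pow_le_pow_left' h 2).trans ?_
  have hw : ENNReal.ofReal (1 - s) + ENNReal.ofReal s = 1 := by
    rw [← ENNReal.ofReal_add (sub_nonneg.2 h1) h0, sub_add_cancel, ENNReal.ofReal_one]
  -- Convexity of the square on `[0, ∞]`.
  simpa using ENNReal.rpow_arith_mean_le_arith_mean2_rpow _ _
    (directionalNorm ((2 * Real.pi)⁻¹ • EuclideanSpace.single j 1) (freeSchrodinger a u)
      (freeSchrodinger a v))
    (directionalNorm ((2 * Real.pi)⁻¹ • EuclideanSpace.single j 1) (freeSchrodinger b u)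
      (freeSchrodinger b v)) hw one_le_two

theorem interactionNormSq_lt_top_of_two_times {u v : L2} {a b : ℝ} (hab : a ≠ b)
    (ha : interactionNormSq (freeSchrodinger a u) (freeSchrodinger a v) < ∞)
    (hb : interactionNormSq (freeSchrodinger b u) (freeSchrodinger b v) < ∞) (t : ℝ) :
    interactionNormSq (freeSchrodinger t u) (freeSchrodinger t v) < ∞ := by
  rw [interactionNormSq_lt_top_iff] at *
  intro j
  have hne : b - a ≠ 0 := sub_ne_zero.2 hab.symm
  have ht : (1 - (t - a) / (b - a)) * a + (t - a) / (b - a) * b = t := by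
    field_simp
    ring
  -- For `t` not between `a` and `b` this extrapolates: one weight is negative, which only its
  -- absolute value sees.
  have h := directionalNorm_combination_le (sub_add_cancel 1 ((t - a) / (b - a))) a b
    ((2 * Real.pi)⁻¹ • EuclideanSpace.single j 1) u v
  rw [ht] at h
  exact h.trans_lt (ENNReal.add_lt_top.2
    ⟨ENNReal.mul_lt_top enorm_lt_top (ha j), ENNReal.mul_lt_top enorm_lt_top (hb j)⟩)

theorem interactionNormSq_lt_top_of_fourier {u v : L2} {a : ℝ}
    (ha : interactionNormSq (freeSchrodinger a u) (freeSchrodinger a v) < ∞)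
    (hF : interactionNormSq (𝓕 u) (𝓕 v) < ∞) (t : ℝ) :
    interactionNormSq (freeSchrodinger t u) (freeSchrodinger t v) < ∞ := by
  rw [interactionNormSq_lt_top_iff] at *
  exact fun j => (directionalNorm_freeSchrodinger_le_add a t _ u v).trans_lt
    (ENNReal.add_lt_top.2 ⟨ha j, ENNReal.mul_lt_top enorm_lt_top (hF j)⟩)

end Interaction

theorem convexOn_toReal_of_ennreal {F : ℝ → ℝ≥0∞} (hF : ∀ t, F t < ∞)
    (h : ∀ a b s : ℝ, 0 ≤ s → s ≤ 1 →
      F ((1 - s) * a + s * b) ≤ ENNReal.ofReal (1 - s) * F a + ENNReal.ofReal s * F b) :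
    ConvexOn ℝ Set.univ fun t => (F t).toReal := by
  refine ⟨convex_univ, fun a _ b _ r s hr hs hrs => ?_⟩
  obtain rfl : r = 1 - s := by linarith
  have hfin : ∀ (c t : ℝ), ENNReal.ofReal c * F t ≠ ∞ := fun c t =>
    ENNReal.mul_ne_top ENNReal.ofReal_ne_top (hF t).ne
  have := ENNReal.toReal_mono (ENNReal.add_ne_top.2 ⟨hfin _ a, hfin _ b⟩)
    (h a b s hs (by linarith))
  rwa [ENNReal.toReal_add (hfin _ a) (hfin _ b), ENNReal.toReal_mul, ENNReal.toReal_mul,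
    ENNReal.toReal_ofReal hr, ENNReal.toReal_ofReal hs] at this

theorem corollary3p5 (n : ℕ)
    (u₀ v₀ : Lp ℂ 2 (volume : Measure (EuclideanSpace ℝ (Fin n)))) :
    -- convexity on `ℝ` as a function with values in `[0, ∞]`
    (∀ a b s : ℝ, 0 ≤ s → s ≤ 1 →
      interactionNormSq (freeSchrodinger ((1 - s) * a + s * b) u₀)
          (freeSchrodinger ((1 - s) * a + s * b) v₀) ≤
        ENNReal.ofReal (1 - s) * interactionNormSq (freeSchrodinger a u₀) (freeSchrodinger a v₀) +
        ENNReal.ofReal s * interactionNormSq (freeSchrodinger b u₀) (freeSchrodinger b v₀)) ∧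
    -- finiteness at all times, and convexity as a real function
    (((∃ t₁ t₂ : ℝ, t₁ ≠ t₂ ∧
          interactionNormSq (freeSchrodinger t₁ u₀) (freeSchrodinger t₁ v₀) < ∞ ∧
          interactionNormSq (freeSchrodinger t₂ u₀) (freeSchrodinger t₂ v₀) < ∞) ∨
        (∃ t₁ : ℝ, interactionNormSq (freeSchrodinger t₁ u₀) (freeSchrodinger t₁ v₀) < ∞ ∧
          interactionNormSq (𝓕 u₀) (𝓕 v₀) < ∞)) →
      (∀ t : ℝ, interactionNormSq (freeSchrodinger t u₀) (freeSchrodinger t v₀) < ∞) ∧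
      ConvexOn ℝ Set.univ (fun t : ℝ =>
        (interactionNormSq (freeSchrodinger t u₀) (freeSchrodinger t v₀)).toReal)) := by
  have hconv := fun a b s : ℝ => interactionNormSq_freeSchrodinger_convex u₀ v₀ a b (s := s)
  refine ⟨hconv, fun hfin => ?_⟩
  have htop : ∀ t : ℝ, interactionNormSq (freeSchrodinger t u₀) (freeSchrodinger t v₀) < ∞ := by
    rcases hfin with ⟨a, b, hab, ha, hb⟩ | ⟨a, ha, hF⟩
    · exact interactionNormSq_lt_top_of_two_times hab ha hb
    · exact interactionNormSq_lt_top_of_fourier ha hF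
  exact ⟨htop, convexOn_toReal_of_ennreal htop hconv⟩
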